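/- Consider an $M/M/\infty$ queue with arrival rate $\rho>0$ and unit service rate which is empty at time $0$: customers arrive according to a Poisson process with intensity $\rho$ and each customer starts service immediately upon arrival; the service times are independent exponential random variables with mean $1$, independent of the arrival process. For $t\ge 0$ let $A(t)$ and $D(t)$ be the numbers of arrivals and of departures of customers in $[0,t]$; almost surely both are finite. Suppose that an observer watches the queue and leaves at time $t$, and let $$K(t)=A(t)+D(t)+1$$ be the number of arrivals and departures up to time $t$ in the system composed of the queue and the observer, where the departure of the observer counts as the last event. Then for every $t\ge 0$ and every $z\in\mathbb{C}$ the random variable $z^{K(t)}$ is integrable and $$\mathbb{E}\left(z^{K(t)}\right)=z\,\exp\left(\rho z(1-z)\left(1-e^{-t}\right)-\rho\left(1-z^2\right)t\right).$$ -/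

import Mathlib

open MeasureTheory ProbabilityTheory

namespace MMInfty

/-- The primitive data of an `M/M/∞` system which is empty at time `0`, with arrival rate `ρ`
and unit service rate: `X n` is the time between the `n`-th arrival and the previous one (or
time `0`, for `n = 0`), and `S n` is the service time of the `n`-th customer. The interarrival
times are exponential with parameter `ρ`, i.e. customers arrive according to a Poisson process
with intensity `ρ`; the service times are exponential with mean `1`; all these random variables
are mutually independent. There are infinitely many servers: service starts upon arrival. -/
structure IsSystem {Ω : Type*} [MeasurableSpace Ω] (P : Measure Ω) (ρ : ℝ)
    (X S : ℕ → Ω → ℝ) : Prop where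
  measurable_interarrival : ∀ n, Measurable (X n)
  measurable_service : ∀ n, Measurable (S n)
  law_interarrival : ∀ n, P.map (X n) = expMeasure ρ
  law_service : ∀ n, P.map (S n) = expMeasure 1
  indep : iIndepFun (fun i : ℕ ⊕ ℕ => Sum.elim X S i) P

variable {Ω : Type*}

/-- The arrival epoch of the `n`-th customer, `n = 0, 1, 2, …`. -/
def arrivalTime (X : ℕ → Ω → ℝ) (n : ℕ) (ω : Ω) : ℝ :=
  ∑ i ∈ Finset.range (n + 1), X i ω

/-- The epoch at which the `n`-th customer leaves the system: every customer is served
immediately, by a server of their own. -/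
def departureTime (X S : ℕ → Ω → ℝ) (n : ℕ) (ω : Ω) : ℝ :=
  arrivalTime X n ω + S n ω

/-- The customers who have arrived up to time `t`. -/
def arrived (X : ℕ → Ω → ℝ) (t : ℝ) (ω : Ω) : Set ℕ :=
  {n | arrivalTime X n ω ≤ t}

/-- The customers who have left the system up to time `t`. -/
def departed (X S : ℕ → Ω → ℝ) (t : ℝ) (ω : Ω) : Set ℕ :=
  {n | departureTime X S n ω ≤ t}

/-- `A(t)`, the number of arrivals up to time `t`. -/
noncomputable def numArrivals (X : ℕ → Ω → ℝ) (t : ℝ) (ω : Ω) : ℕ :=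
  (arrived X t ω).ncard

/-- `D(t)`, the number of departures of customers up to time `t`. -/
noncomputable def numDepartures (X S : ℕ → Ω → ℝ) (t : ℝ) (ω : Ω) : ℕ :=
  (departed X S t ω).ncard

/-- `K(t)`, the number of events (arrivals and departures) up to time `t` in the system composed
of the queue and an observer who leaves at time `t`. The departure of the observer is itself
counted, as the last event, whence the summand `1`. So if the observer leaves after an
independent exponential time `τ` with mean `1/σ`, then `K(τ) = κ(σ)` is the step at which the
embedded Markov chain of the composed system is absorbed, and `A(τ) + D(τ) = κ(σ) - 1`. -/
noncomputable def K (X S : ℕ → Ω → ℝ) (t : ℝ) (ω : Ω) : ℕ :=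
  numArrivals X t ω + numDepartures X S t ω + 1

end MMInfty

open MeasureTheory ProbabilityTheory Set

/-! Split `z ^ (A + D)` according to the value `n` of `A(t)`. Each customer arriving `u` before `t`
contributes `z`, or `z ^ 2` if already gone, so each piece (`weight`) is a product of marks and
indicators, with a recursion that removes the first customer. The remaining customers form an
independent copy of the system with horizon `t - X 0`; this renewal argument
(`IsSystem.integral_weight`) gives the piece the mean `exp(-ρt) (ρ M(t))^n / n!`, where `M =
meanMark`. Summing over `n` yields `exp(ρ M(t) - ρt)`, the stated exponential. The same formula
justifies the exchange of sum and integral, since the norm of a weight is the weight at `‖z‖`. At `z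
= 1` it shows that the probabilities of `A(t) = n` sum to `1`, so arrivals are almost surely finite.
-/

namespace MMInfty

/-! ### Sample paths: removing the first customer. -/

section Path

variable {Ω : Type*} {X S : ℕ → Ω → ℝ} {t : ℝ} {ω : Ω}

lemma arrivalTime_succ (n : ℕ) :
    arrivalTime X (n + 1) ω = X 0 ω + arrivalTime (fun k => X (k + 1)) n ω := by
  simp only [arrivalTime]
  rw [Finset.sum_range_succ' _ (n + 1), add_comm]

lemma le_arrivalTime (hX : ∀ n, 0 ≤ X n ω) (n : ℕ) : X 0 ω ≤ arrivalTime X n ω :=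
  Finset.single_le_sum (f := fun i => X i ω) (fun i _ => hX i) (by simp)

lemma departed_subset_arrived (hS : ∀ n, 0 ≤ S n ω) : departed X S t ω ⊆ arrived X t ω := by
  intro n hn
  have h := hS n
  simp only [departed, arrived, departureTime, mem_ofPred_eq] at hn ⊢
  linarith

lemma arrived_eq_empty (hX : ∀ n, 0 ≤ X n ω) (ht : t < X 0 ω) : arrived X t ω = ∅ := by
  ext n
  have := le_arrivalTime hX n
  simp only [arrived, mem_ofPred_eq, mem_empty_iff_false, iff_false, not_le]
  linarith

lemma arrived_eq_insert (ht : X 0 ω ≤ t) :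
    arrived X t ω = insert 0 (Nat.succ '' arrived (fun k => X (k + 1)) (t - X 0 ω) ω) := by
  ext n
  cases n with
  | zero => simp [arrived, arrivalTime, ht]
  | succ n => simp [arrived, arrivalTime_succ, le_sub_iff_add_le']

lemma mem_departed_succ (n : ℕ) : n + 1 ∈ departed X S t ω ↔
    n ∈ departed (fun k => X (k + 1)) (fun k => S (k + 1)) (t - X 0 ω) ω := by
  simp only [departed, departureTime, arrivalTime_succ, mem_ofPred_eq]
  constructor <;> intro h <;> linarith

lemma zero_mem_departed : 0 ∈ departed X S t ω ↔ S 0 ω ≤ t - X 0 ω := by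
  simp only [departed, departureTime, arrivalTime, mem_ofPred_eq, zero_add, Finset.sum_range_one]
  constructor <;> intro h <;> linarith

lemma departed_eq_of_le (h : S 0 ω ≤ t - X 0 ω) :
    departed X S t ω = insert 0
      (Nat.succ '' departed (fun k => X (k + 1)) (fun k => S (k + 1)) (t - X 0 ω) ω) := by
  ext n
  cases n with
  | zero => simp [zero_mem_departed, h]
  | succ n => simp [mem_departed_succ]

lemma departed_eq_of_lt (h : t - X 0 ω < S 0 ω) :
    departed X S t ω =
      Nat.succ '' departed (fun k => X (k + 1)) (fun k => S (k + 1)) (t - X 0 ω) ω := by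
  ext n
  cases n with
  | zero => simp [zero_mem_departed, h]
  | succ n => simp [mem_departed_succ]

lemma ncard_insert_zero_image_succ {s : Set ℕ} (hs : s.Finite) :
    (insert 0 (Nat.succ '' s)).ncard = s.ncard + 1 := by
  rw [ncard_insert_of_notMem (by simp) (hs.image _), ncard_image_of_injective _ Nat.succ_injective]

end Path

/-! ### Weights: the pieces with a fixed number of arrivals. -/

/-- The factor contributed to `z ^ (A + D)` by a customer with service time `s` who arrived
`u` units of time ago. -/
noncomputable def mark (z : ℂ) (u s : ℝ) : ℂ := if s ≤ u then z ^ 2 else z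

/-- The value of `z ^ (A(t) + D(t))` on the event `A(t) = n`, and `0` off this event, as a function
of the sequence `y` of pairs of an interarrival time and a service time, computed by conditioning
on the first customer. -/
noncomputable def weight (z : ℂ) : ℕ → ℝ → (ℕ → ℝ × ℝ) → ℂ
  | 0, t, y => if t < (y 0).1 then 1 else 0
  | n + 1, t, y =>
    if (y 0).1 ≤ t then
      mark z (t - (y 0).1) (y 0).2 * weight z n (t - (y 0).1) (fun k => y (k + 1))
    else 0

-- Finiteness must be required separately: `ncard` is `0` on an infinite set, which would otherwise
-- pass for `A(t) = 0`.
open Classical in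
lemma weight_eq {Ω : Type*} (z : ℂ) (n : ℕ) {X S : ℕ → Ω → ℝ} {t : ℝ} {ω : Ω}
    (hX : ∀ n, 0 ≤ X n ω) (hS : ∀ n, 0 ≤ S n ω) :
    weight z n t (fun k => (X k ω, S k ω)) =
      if (arrived X t ω).Finite ∧ numArrivals X t ω = n then
        z ^ (numArrivals X t ω + numDepartures X S t ω) else 0 := by
  induction n generalizing X S t with
  | zero =>
    rcases lt_or_ge t (X 0 ω) with h | h
    · have hA := arrived_eq_empty hX h
      have hD : departed X S t ω = ∅ :=
        subset_empty_iff.1 (hA ▸ departed_subset_arrived hS)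
      simp [weight, h, numArrivals, numDepartures, hA, hD]
    · have h0 : 0 ∈ arrived X t ω := by simpa [arrived, arrivalTime] using h
      rw [if_neg]
      · simp [weight, h]
      · rintro ⟨hf, hn⟩
        rw [numArrivals, ncard_eq_zero hf] at hn
        simp [hn] at h0
  | succ n ih =>
    rcases lt_or_ge t (X 0 ω) with h | h
    · simp [weight, h, numArrivals, arrived_eq_empty hX h]
    have ih' := ih (X := fun k => X (k + 1)) (S := fun k => S (k + 1)) (t := t - X 0 ω)
      (fun n => hX _) (fun n => hS _)
    have hA := arrived_eq_insert h
    simp only [weight, h, if_true]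
    rw [ih']
    by_cases hf : (arrived (fun k => X (k + 1)) (t - X 0 ω) ω).Finite
    swap
    · have : ¬ (arrived X t ω).Finite := by
        rw [hA, finite_insert, finite_image_iff Nat.succ_injective.injOn]
        exact hf
      simp [hf, this]
    have hf' : (arrived X t ω).Finite := by
      rw [hA]; exact (hf.image _).insert _
    have hAn : numArrivals X t ω = numArrivals (fun k => X (k + 1)) (t - X 0 ω) ω + 1 := by
      rw [numArrivals, hA, ncard_insert_zero_image_succ hf, numArrivals]
    have hfd : (departed (fun k => X (k + 1)) (fun k => S (k + 1)) (t - X 0 ω) ω).Finite :=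
      hf.subset (departed_subset_arrived fun n => hS _)
    simp only [hf, hf', true_and, hAn, add_left_inj]
    split_ifs with hn
    · rcases lt_or_ge (t - X 0 ω) (S 0 ω) with hs | hs
      · have hDn : numDepartures X S t ω =
            numDepartures (fun k => X (k + 1)) (fun k => S (k + 1)) (t - X 0 ω) ω := by
          rw [numDepartures, departed_eq_of_lt hs,
            ncard_image_of_injective _ Nat.succ_injective, numDepartures]
        rw [hDn, mark, if_neg (not_le.2 hs)]
        ring
      · have hDn : numDepartures X S t ω =
            numDepartures (fun k => X (k + 1)) (fun k => S (k + 1)) (t - X 0 ω) ω + 1 := by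
          rw [numDepartures, departed_eq_of_le hs, ncard_insert_zero_image_succ hfd, numDepartures]
        rw [hDn, mark, if_pos hs]
        ring
    · simp

open Classical in
lemma hasSum_weight {Ω : Type*} {X S : ℕ → Ω → ℝ} (z : ℂ) {t : ℝ} {ω : Ω} (hX : ∀ n, 0 ≤ X n ω) (hS : ∀ n, 0 ≤ S n ω) :
    HasSum (fun n => weight z n t (fun k => (X k ω, S k ω)))
      (if (arrived X t ω).Finite then z ^ (numArrivals X t ω + numDepartures X S t ω) else 0) := by
  have := hasSum_ite_eq (numArrivals X t ω) (if (arrived X t ω).Finite then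
    z ^ (numArrivals X t ω + numDepartures X S t ω) else 0)
  convert! this using 2 with n
  rw [weight_eq z n hX hS]
  by_cases hf : (arrived X t ω).Finite <;> simp [hf, eq_comm]

lemma norm_mark_le (z : ℂ) (u s : ℝ) : ‖mark z u s‖ ≤ ‖z‖ + ‖z‖ ^ 2 := by
  unfold mark
  split_ifs
  · rw [norm_pow]; linarith [norm_nonneg z]
  · linarith [sq_nonneg ‖z‖]

lemma norm_weight_le (z : ℂ) (n : ℕ) (t : ℝ) (y : ℕ → ℝ × ℝ) :
    ‖weight z n t y‖ ≤ (‖z‖ + ‖z‖ ^ 2) ^ n := by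
  induction n generalizing t y with
  | zero => unfold weight; split_ifs <;> simp
  | succ n ih =>
    unfold weight
    split_ifs
    · rw [norm_mul, pow_succ']
      exact mul_le_mul (norm_mark_le _ _ _) (ih _ _) (norm_nonneg _) (by positivity)
    · rw [norm_zero]; positivity

lemma ofReal_norm_mark (z : ℂ) (u s : ℝ) : (‖mark z u s‖ : ℂ) = mark (‖z‖ : ℂ) u s := by
  unfold mark
  split_ifs <;> simp

/-- Reduces absolute summability of the means to the formula for the means at `‖z‖`. -/
lemma ofReal_norm_weight (z : ℂ) (n : ℕ) (t : ℝ) (y : ℕ → ℝ × ℝ) :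
    (‖weight z n t y‖ : ℂ) = weight (‖z‖ : ℂ) n t y := by
  induction n generalizing t y with
  | zero => unfold weight; split_ifs <;> simp
  | succ n ih =>
    unfold weight
    split_ifs
    · rw [norm_mul, Complex.ofReal_mul, ofReal_norm_mark, ih]
    · simp

lemma measurable_mark (z : ℂ) : Measurable fun p : ℝ × ℝ => mark z p.1 p.2 :=
  Measurable.ite (measurableSet_le measurable_snd measurable_fst) measurable_const measurable_const

lemma measurable_weight (z : ℂ) (n : ℕ) :
    Measurable fun p : ℝ × (ℕ → ℝ × ℝ) => weight z n p.1 p.2 := by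
  induction n with
  | zero =>
    exact Measurable.ite (measurableSet_lt (by fun_prop) (by fun_prop)) measurable_const
      measurable_const
  | succ n ih =>
    refine Measurable.ite (measurableSet_le (by fun_prop) (by fun_prop)) (Measurable.mul ?_ ?_)
      measurable_const
    · exact (measurable_mark z).comp
        (f := fun p : ℝ × (ℕ → ℝ × ℝ) => (p.1 - (p.2 0).1, (p.2 0).2)) (by fun_prop)
    · exact ih.comp
        (f := fun p : ℝ × (ℕ → ℝ × ℝ) => (p.1 - (p.2 0).1, fun k => p.2 (k + 1))) (by fun_prop)

/-! ### Integrals against exponential laws. -/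

lemma integral_expMeasure {r : ℝ} (hr : 0 < r) (f : ℝ → ℂ) :
    ∫ x, f x ∂expMeasure r = ∫ x in Ici 0, ((r * Real.exp (-(r * x)) : ℝ) : ℂ) * f x := by
  have h : expMeasure r = volume.withDensity (exponentialPDF r) := rfl
  rw [h, integral_withDensity_eq_integral_toReal_smul
    (f := exponentialPDF r) (measurable_exponentialPDFReal r).ennreal_ofReal
    (by simp [exponentialPDF]),
    ← integral_indicator measurableSet_Ici]
  congr 1 with x
  by_cases hx : 0 ≤ x
  · rw [indicator_of_mem (mem_Ici.2 hx), exponentialPDF_of_nonneg hx,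
      ENNReal.toReal_ofReal (by positivity), Complex.real_smul]
  · rw [indicator_of_notMem (by simpa using hx), exponentialPDF_of_neg (not_le.1 hx)]
    simp

lemma integral_mark (z : ℂ) {u : ℝ} (hu : 0 ≤ u) :
    ∫ s, mark z u s ∂expMeasure 1 = z + (z ^ 2 - z) * (1 - Real.exp (-u) : ℝ) := by
  have := isProbabilityMeasure_expMeasure one_pos
  have h : ∀ s, mark z u s = z + (Iic u).indicator (fun _ => z ^ 2 - z) s := by
    intro s
    by_cases hs : s ≤ u <;> simp [mark, hs]
  simp only [h]
  rw [integral_add (integrable_const _) ((integrable_const _).indicator measurableSet_Iic),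
    integral_indicator_const _ measurableSet_Iic, ← cdf_eq_real, cdf_expMeasure_eq one_pos,
    if_pos hu]
  simp [mul_comm]

/-- The integral over `[0, t]` of the expected `mark`. -/
noncomputable def meanMark (z : ℂ) (t : ℝ) : ℂ :=
  z * t + (z ^ 2 - z) * (t - (1 - Real.exp (-t)) : ℝ)

lemma hasDerivAt_meanMark (z : ℂ) (t : ℝ) :
    HasDerivAt (meanMark z) (z + (z ^ 2 - z) * (1 - Real.exp (-t) : ℝ)) t := by
  have h1 : HasDerivAt (fun t : ℝ => t - (1 - Real.exp (-t))) (1 - Real.exp (-t)) t := by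
    have := (hasDerivAt_id t).sub (((hasDerivAt_neg t).exp).const_sub 1)
    convert! this using 1
    ring
  have h2 := ((hasDerivAt_id t).ofReal_comp.const_mul z).add (h1.ofReal_comp.const_mul (z ^ 2 - z))
  convert! h2 using 1
  simp

/-- The expectation of `weight`. -/
noncomputable def meanWeight (ρ : ℝ) (z : ℂ) (n : ℕ) (t : ℝ) : ℂ :=
  (Real.exp (-(ρ * t)) : ℝ) * ((ρ * meanMark z t) ^ n / n.factorial)

/-- The renewal step: `exp(-ρx) exp(-ρ(t-x))` does not depend on `x`, so the integrand times the
density is an exact derivative of a power of `M(t - x)`; the endpoint `x = t` contributes nothing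
because `M(0) = 0`. -/
lemma integral_meanWeight {ρ : ℝ} (hρ : 0 < ρ) (z : ℂ) (n : ℕ) {t : ℝ} (ht : 0 ≤ t) :
    ∫ x, (Iic t).indicator (fun x => (z + (z ^ 2 - z) * (1 - Real.exp (-(t - x)) : ℝ)) *
      meanWeight ρ z n (t - x)) x ∂expMeasure ρ = meanWeight ρ z (n + 1) t := by
  have hG (x : ℝ) : HasDerivAt (fun x => meanMark z (t - x))
      (-(z + (z ^ 2 - z) * (1 - Real.exp (-(t - x)) : ℝ))) x := by
    have := (hasDerivAt_meanMark z (t - x)).scomp x ((hasDerivAt_id x).const_sub t)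
    convert! this using 1
    rw [neg_one_smul]
  have hGc : Continuous (meanMark z) :=
    continuous_iff_continuousAt.2 fun x => (hasDerivAt_meanMark z x).continuousAt
  have hd (x : ℝ) : HasDerivAt (fun x => -((Real.exp (-(ρ * t)) : ℝ) : ℂ) *
        ((ρ * meanMark z (t - x)) ^ (n + 1) / (n + 1).factorial))
      (((ρ * Real.exp (-(ρ * x)) : ℝ) : ℂ) *
        ((z + (z ^ 2 - z) * (1 - Real.exp (-(t - x)) : ℝ)) * meanWeight ρ z n (t - x))) x := by
    have := ((((hG x).const_mul (ρ : ℂ)).pow (n + 1)).div_const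
      ((n + 1).factorial : ℂ)).const_mul (-((Real.exp (-(ρ * t)) : ℝ) : ℂ))
    convert! this using 1
    have he : Real.exp (-(ρ * t)) = Real.exp (-(ρ * x)) * Real.exp (-(ρ * (t - x))) := by
      rw [← Real.exp_add]; ring_nf
    have hn : (n.factorial : ℂ) ≠ 0 := by exact_mod_cast n.factorial_ne_zero
    have hn' : (n : ℂ) + 1 ≠ 0 := by exact_mod_cast n.succ_ne_zero
    simp only [meanWeight, he, Nat.factorial_succ, Nat.add_sub_cancel]
    push_cast
    field_simp
  rw [integral_expMeasure hρ]
  have hi : ∀ x : ℝ, ((ρ * Real.exp (-(ρ * x)) : ℝ) : ℂ) *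
      (Iic t).indicator (fun x => (z + (z ^ 2 - z) * (1 - Real.exp (-(t - x)) : ℝ)) *
        meanWeight ρ z n (t - x)) x =
      (Iic t).indicator (fun x => ((ρ * Real.exp (-(ρ * x)) : ℝ) : ℂ) *
        ((z + (z ^ 2 - z) * (1 - Real.exp (-(t - x)) : ℝ)) * meanWeight ρ z n (t - x))) x := by
    intro x
    by_cases hx : x ∈ Iic t <;> simp [hx]
  simp only [hi]
  rw [setIntegral_indicator measurableSet_Iic, Ici_inter_Iic, integral_Icc_eq_integral_Ioc,
    ← intervalIntegral.integral_of_le ht,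
    intervalIntegral.integral_eq_sub_of_hasDerivAt (fun x _ => hd x)]
  · simp [meanWeight, meanMark]
  · apply Continuous.intervalIntegrable
    unfold meanWeight
    fun_prop

/-! ### Mean of a weight, by independence of the first customer from the rest. -/

section System

variable {Ω : Type*} [MeasurableSpace Ω] {P : Measure Ω} {ρ : ℝ} {X S : ℕ → Ω → ℝ}

lemma IsSystem.shift (h : IsSystem P ρ X S) :
    IsSystem P ρ (fun n => X (n + 1)) (fun n => S (n + 1)) where
  measurable_interarrival n := h.measurable_interarrival _
  measurable_service n := h.measurable_service _
  law_interarrival n := h.law_interarrival _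
  law_service n := h.law_service _
  indep := by
    have := h.indep.precomp (g := Sum.map Nat.succ Nat.succ)
      (Sum.map_injective.2 ⟨Nat.succ_injective, Nat.succ_injective⟩)
    convert! this using 1
    funext i
    cases i <;> rfl

lemma IsSystem.measurable_sum (h : IsSystem P ρ X S) (i : ℕ ⊕ ℕ) : Measurable (Sum.elim X S i) := by
  cases i
  · exact h.measurable_interarrival _
  · exact h.measurable_service _

/-- The two sides are measurable with respect to σ-algebras generated by disjoint sets of indices in
`ℕ ⊕ ℕ`. -/
lemma IsSystem.indepFun_first (h : IsSystem P ρ X S) :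
    IndepFun (fun ω => (X 0 ω, S 0 ω)) (fun ω n => (X (n + 1) ω, S (n + 1) ω)) P := by
  have hd : Disjoint ({Sum.inl 0, Sum.inr 0} : Set (ℕ ⊕ ℕ))
      (range (Sum.map Nat.succ Nat.succ)) := by
    rw [Set.disjoint_left]
    rintro _ (rfl | rfl) ⟨i, hi⟩ <;> cases i <;> simp at hi
  have hI := indep_iSup_of_disjoint (fun i => (h.measurable_sum i).comap_le) h.indep hd
  have hm (T : Set (ℕ ⊕ ℕ)) (i : ℕ ⊕ ℕ) (hi : i ∈ T) :
      Measurable[⨆ i ∈ T, MeasurableSpace.comap (Sum.elim X S i) inferInstance]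
        (Sum.elim X S i) := by
    rw [measurable_iff_comap_le]
    exact le_iSup₂_of_le i hi le_rfl
  refine indep_of_indep_of_le_left (indep_of_indep_of_le_right hI ?_) ?_
  · rw [← measurable_iff_comap_le]
    refine (@measurable_pi_iff _ _ _ (_) _ _).2 fun n => Measurable.prodMk ?_ ?_
    · exact hm _ (Sum.inl (n + 1)) ⟨Sum.inl n, rfl⟩
    · exact hm _ (Sum.inr (n + 1)) ⟨Sum.inr n, rfl⟩
  · rw [← measurable_iff_comap_le]
    refine Measurable.prodMk ?_ ?_
    · exact hm _ (Sum.inl 0) (by simp)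
    · exact hm _ (Sum.inr 0) (by simp)

lemma IsSystem.map_first [IsProbabilityMeasure P] (h : IsSystem P ρ X S) :
    P.map (fun ω => (X 0 ω, S 0 ω)) = (expMeasure ρ).prod (expMeasure 1) := by
  have hi : IndepFun (X 0) (S 0) P :=
    h.indep.indepFun (i := Sum.inl 0) (j := Sum.inr 0) (by simp)
  rw [hi.map_prod_eq_prod_map_map (h.measurable_interarrival 0).aemeasurable
    (h.measurable_service 0).aemeasurable, h.law_interarrival, h.law_service]

lemma IsSystem.measurable_pairs (h : IsSystem P ρ X S) :
    Measurable fun ω (n : ℕ) => (X n ω, S n ω) :=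
  measurable_pi_lambda _ fun n => (h.measurable_interarrival n).prodMk (h.measurable_service n)

lemma IsSystem.measurable_weight (h : IsSystem P ρ X S) (z : ℂ) (n : ℕ) (t : ℝ) :
    Measurable fun ω => weight z n t fun k => (X k ω, S k ω) :=
  (MMInfty.measurable_weight z n).comp (measurable_const.prodMk h.measurable_pairs)

lemma IsSystem.integrable_weight [IsProbabilityMeasure P] (h : IsSystem P ρ X S) (z : ℂ) (n : ℕ)
    (t : ℝ) : Integrable (fun ω => weight z n t fun k => (X k ω, S k ω)) P :=
  .of_bound (h.measurable_weight z n t).aestronglyMeasurable _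
    (.of_forall fun _ => norm_weight_le _ _ _ _)

lemma IsSystem.integral_weight [IsProbabilityMeasure P] (hρ : 0 < ρ) (h : IsSystem P ρ X S) (z : ℂ)
    (n : ℕ) {t : ℝ} (ht : 0 ≤ t) :
    ∫ ω, weight z n t (fun k => (X k ω, S k ω)) ∂P = meanWeight ρ z n t := by
  have := isProbabilityMeasure_expMeasure hρ
  have := isProbabilityMeasure_expMeasure one_pos
  induction n generalizing X S t with
  | zero =>
    have h1 : ∀ ω, weight z 0 t (fun k => (X k ω, S k ω)) =
        1 - (Iic t).indicator (fun _ => (1 : ℂ)) (X 0 ω) := by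
      intro ω
      by_cases hx : X 0 ω ≤ t
      · simp [weight, hx]
      · simp [weight, hx, not_le.1 hx]
    simp only [h1]
    rw [← integral_map (φ := X 0) (f := fun x => 1 - (Iic t).indicator (fun _ => (1 : ℂ)) x)
      (h.measurable_interarrival 0).aemeasurable
      (Measurable.aestronglyMeasurable
        (measurable_const.sub (measurable_const.indicator measurableSet_Iic))),
      h.law_interarrival,
      integral_sub (integrable_const _) ((integrable_const _).indicator measurableSet_Iic),
      integral_indicator_const _ measurableSet_Iic, ← cdf_eq_real, cdf_expMeasure_eq hρ, if_pos ht]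
    simp [meanWeight]
  | succ n ih =>
    set μ := P.map (fun ω (n : ℕ) => (X (n + 1) ω, S (n + 1) ω)) with hμ
    have : IsProbabilityMeasure μ :=
      Measure.isProbabilityMeasure_map h.shift.measurable_pairs.aemeasurable
    have hF : Measurable fun p : (ℝ × ℝ) × (ℕ → ℝ × ℝ) =>
        if p.1.1 ≤ t then mark z (t - p.1.1) p.1.2 * weight z n (t - p.1.1) p.2 else 0 := by
      refine Measurable.ite (measurableSet_le (by fun_prop) (by fun_prop)) (Measurable.mul ?_ ?_)
        measurable_const
      · exact (measurable_mark z).comp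
          (f := fun p : (ℝ × ℝ) × (ℕ → ℝ × ℝ) => (t - p.1.1, p.1.2)) (by fun_prop)
      · exact (MMInfty.measurable_weight z n).comp
          (f := fun p : (ℝ × ℝ) × (ℕ → ℝ × ℝ) => (t - p.1.1, p.2)) (by fun_prop)
    have hXS := (h.measurable_interarrival 0).prodMk (h.measurable_service 0)
    have hmap := h.indepFun_first.map_prod_eq_prod_map_map hXS.aemeasurable
      h.shift.measurable_pairs.aemeasurable
    rw [h.map_first, ← hμ] at hmap
    -- The induction hypothesis is applied to the shifted system, with the remaining time `t - x` as
    -- horizon.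
    have hinner (x : ℝ) (hx : x ≤ t) : ∫ y, weight z n (t - x) y ∂μ = meanWeight ρ z n (t - x) := by
      rw [hμ, integral_map h.shift.measurable_pairs.aemeasurable, ih h.shift (by linarith)]
      exact ((MMInfty.measurable_weight z n).comp
        (measurable_const.prodMk measurable_id)).aestronglyMeasurable
    have hFb : ∀ p : (ℝ × ℝ) × (ℕ → ℝ × ℝ),
        ‖(if p.1.1 ≤ t then mark z (t - p.1.1) p.1.2 * weight z n (t - p.1.1) p.2 else 0 : ℂ)‖ ≤
          (‖z‖ + ‖z‖ ^ 2) * (‖z‖ + ‖z‖ ^ 2) ^ n := by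
      intro p
      split_ifs
      · rw [norm_mul]
        exact mul_le_mul (norm_mark_le _ _ _) (norm_weight_le _ _ _ _) (norm_nonneg _)
          (by positivity)
      · rw [norm_zero]; positivity
    have hFi := Integrable.of_bound (μ := ((expMeasure ρ).prod (expMeasure 1)).prod μ)
      hF.aestronglyMeasurable _ (.of_forall hFb)
    calc ∫ ω, weight z (n + 1) t (fun k => (X k ω, S k ω)) ∂P
        = ∫ p, (if p.1.1 ≤ t then mark z (t - p.1.1) p.1.2 * weight z n (t - p.1.1) p.2 else 0)
            ∂((expMeasure ρ).prod (expMeasure 1)).prod μ := by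
          rw [← hmap, integral_map (hXS.prodMk h.shift.measurable_pairs).aemeasurable
            hF.aestronglyMeasurable]
          simp only [weight]
      _ = ∫ x, ∫ s, ∫ y, (if x ≤ t then mark z (t - x) s * weight z n (t - x) y else 0)
            ∂μ ∂expMeasure 1 ∂expMeasure ρ := by
          rw [integral_prod _ hFi, integral_prod _ hFi.integral_prod_left]
      _ = ∫ x, (Iic t).indicator (fun x => (z + (z ^ 2 - z) * (1 - Real.exp (-(t - x)) : ℝ)) *
            meanWeight ρ z n (t - x)) x ∂expMeasure ρ := by
          congr 1 with x
          by_cases hx : x ≤ t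
          · simp only [hx, if_true, integral_const_mul, hinner x hx, integral_mul_const,
              integral_mark z (sub_nonneg.2 hx), mem_Iic, indicator_of_mem]
          · simp [hx]
      _ = meanWeight ρ z (n + 1) t := integral_meanWeight hρ z n ht

/-! ### Summation over the number of arrivals, and almost sure finiteness. -/

lemma hasSum_meanWeight (ρ : ℝ) (z : ℂ) (t : ℝ) :
    HasSum (fun n => meanWeight ρ z n t)
      (Complex.exp (-(ρ * t)) * Complex.exp (ρ * meanMark z t)) := by
  have h := (NormedSpace.expSeries_div_hasSum_exp (ρ * meanMark z t : ℂ)).mul_left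
    (Complex.exp (-(ρ * t)))
  rw [← Complex.exp_eq_exp_ℂ] at h
  convert! h using 2
  simp [meanWeight]

lemma IsSystem.summable_integral_norm_weight [IsProbabilityMeasure P] (hρ : 0 < ρ)
    (h : IsSystem P ρ X S) (z : ℂ) {t : ℝ} (ht : 0 ≤ t) :
    Summable fun n => ∫ ω, ‖weight z n t (fun k => (X k ω, S k ω))‖ ∂P := by
  rw [← Complex.summable_ofReal]
  refine (hasSum_meanWeight ρ (‖z‖ : ℂ) t).summable.congr fun n => ?_
  rw [← h.integral_weight hρ _ n ht, ← integral_complex_ofReal]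
  simp only [ofReal_norm_weight]

lemma expMeasure_Iio_zero (r : ℝ) : expMeasure r (Iio 0) = 0 := by
  have h : expMeasure r = volume.withDensity (exponentialPDF r) := rfl
  rw [h, withDensity_apply _ measurableSet_Iio, lintegral_exponentialPDF_of_nonpos le_rfl]

lemma ae_nonneg_of_map_eq {f : Ω → ℝ} (hf : Measurable f) {r : ℝ} (h : P.map f = expMeasure r) :
    ∀ᵐ ω ∂P, 0 ≤ f ω := by
  have := expMeasure_Iio_zero r
  rw [← h, Measure.map_apply hf measurableSet_Iio] at this
  rw [ae_iff]
  simp only [not_le]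
  exact this

lemma IsSystem.ae_nonneg (h : IsSystem P ρ X S) :
    ∀ᵐ ω ∂P, (∀ n, 0 ≤ X n ω) ∧ ∀ n, 0 ≤ S n ω := by
  filter_upwards [ae_all_iff.2 fun n =>
      ae_nonneg_of_map_eq (h.measurable_interarrival n) (h.law_interarrival n),
    ae_all_iff.2 fun n => ae_nonneg_of_map_eq (h.measurable_service n) (h.law_service n)]
    with ω h1 h2 using ⟨h1, h2⟩

lemma meanMark_one (t : ℝ) : meanMark 1 t = t := by
  simp [meanMark]

/-- At `z = 1` the weights sum to the indicator of finiteness, while their means sum to `1`; an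
indicator with mean `1` is almost surely `1`. -/
lemma IsSystem.ae_finite [IsProbabilityMeasure P] (hρ : 0 < ρ) (h : IsSystem P ρ X S) {t : ℝ}
    (ht : 0 ≤ t) : ∀ᵐ ω ∂P, (arrived X t ω).Finite := by
  classical
  have h1 := hasSum_integral_of_summable_integral_norm (fun n => h.integrable_weight 1 n t)
    (h.summable_integral_norm_weight hρ 1 ht)
  simp only [h.integral_weight hρ 1 _ ht] at h1
  have h2 := h1.unique (hasSum_meanWeight ρ 1 t)
  rw [meanMark_one, ← Complex.exp_add, neg_add_cancel, Complex.exp_zero] at h2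
  set f : Ω → ℂ := fun ω => ∑' n, weight 1 n t (fun k => (X k ω, S k ω)) with hf
  have hfe : ∀ᵐ ω ∂P, f ω = if (arrived X t ω).Finite then 1 else 0 := by
    filter_upwards [h.ae_nonneg] with ω hω
    simpa using (hasSum_weight 1 hω.1 hω.2).tsum_eq
  -- A non-integrable function would have integral `0` by convention, but the integral is `1`.
  have hint : Integrable f P := by
    by_contra hc
    rw [integral_undef hc] at h2
    exact zero_ne_one h2
  have hzero : ∫ ω, (1 - (f ω).re) ∂P = 0 := by
    have hre : ∫ ω, (f ω).re ∂P = 1 := by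
      have := integral_re hint
      simp only [RCLike.re_eq_complex_re] at this
      rw [this, h2, Complex.one_re]
    rw [integral_sub (g := fun ω => (f ω).re) (integrable_const _) hint.re]
    simp [hre]
  have hnn : 0 ≤ᵐ[P] fun ω => 1 - (f ω).re := by
    filter_upwards [hfe] with ω hω
    rw [hω]
    split_ifs <;> simp
  have := (integral_eq_zero_iff_of_nonneg_ae hnn ((integrable_const _).sub hint.re)).1 hzero
  filter_upwards [this, hfe] with ω h3 h4
  by_contra hc
  rw [h4, if_neg hc] at h3
  simp at h3

/-- The limit inherits measurability from the partial sums, so the measurability of `A(t)` and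
`D(t)` never has to be proved directly. -/
lemma integrable_of_hasSum {α ι E : Type*} [Countable ι] [MeasurableSpace α] {μ : Measure α}
    [NormedAddCommGroup E] {F : ι → α → E} {f : α → E}
    (hF : ∀ i, Integrable (F i) μ) (hs : Summable fun i => ∫ a, ‖F i a‖ ∂μ)
    (hf : ∀ᵐ a ∂μ, HasSum (fun i => F i a) (f a)) : Integrable f μ := by
  refine ⟨aestronglyMeasurable_of_tendsto_ae Filter.atTop
    (fun s : Finset ι => (integrable_finsetSum s fun i _ => hF i).aestronglyMeasurable)
    (by simpa [HasSum] using hf), ?_⟩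
  have hle : ∫⁻ a, ‖f a‖ₑ ∂μ ≤ ∫⁻ a, ∑' i, ‖F i a‖ₑ ∂μ := by
    refine lintegral_mono_ae ?_
    filter_upwards [hf] with a ha
    rw [← ha.tsum_eq]
    exact enorm_tsum_le_tsum_enorm
  refine hle.trans_lt ?_
  rw [lintegral_tsum fun i => (hF i).aestronglyMeasurable.enorm]
  simp only [← ofReal_integral_norm_eq_lintegral_enorm (hF _)]
  rw [← ENNReal.ofReal_tsum_of_nonneg (fun i => integral_nonneg fun a => norm_nonneg _) hs]
  exact ENNReal.ofReal_lt_top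

end System

end MMInfty

theorem mainTheorem5 {Ω : Type*} [MeasurableSpace Ω] (P : Measure Ω) [IsProbabilityMeasure P]
    (ρ : ℝ) (hρ : 0 < ρ) (X S : ℕ → Ω → ℝ) (hQ : MMInfty.IsSystem P ρ X S)
    (t : ℝ) (ht : 0 ≤ t) :
    (∀ᵐ ω ∂P, (MMInfty.arrived X t ω).Finite ∧ (MMInfty.departed X S t ω).Finite) ∧
    ∀ z : ℂ,
      Integrable (fun ω => z ^ MMInfty.K X S t ω) P ∧
      ∫ ω, z ^ MMInfty.K X S t ω ∂P =
        z * Complex.exp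
          ((ρ : ℂ) * z * (1 - z) * (1 - Complex.exp (-(t : ℂ))) - (ρ : ℂ) * (1 - z ^ 2) * (t : ℂ)) := by
  have hfin := hQ.ae_finite hρ ht
  refine ⟨?_, fun z => ?_⟩
  · filter_upwards [hfin, hQ.ae_nonneg] with ω h1 h2
    exact ⟨h1, h1.subset (MMInfty.departed_subset_arrived h2.2)⟩
  have hs : ∀ᵐ ω ∂P, HasSum (fun n => MMInfty.weight z n t (fun k => (X k ω, S k ω)))
      (z ^ (MMInfty.numArrivals X t ω + MMInfty.numDepartures X S t ω)) := by
    filter_upwards [hfin, hQ.ae_nonneg] with ω h1 h2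
    simpa [h1] using MMInfty.hasSum_weight (t := t) z h2.1 h2.2
  have hsum := hQ.summable_integral_norm_weight hρ z ht
  have hint := MMInfty.integrable_of_hasSum (fun n => hQ.integrable_weight z n t) hsum hs
  simp only [MMInfty.K, pow_succ _ (_ + _)]
  refine ⟨hint.mul_const z, ?_⟩
  have h1 := hasSum_integral_of_summable_integral_norm (fun n => hQ.integrable_weight z n t) hsum
  simp only [hQ.integral_weight hρ z _ ht] at h1
  rw [integral_mul_const, ← integral_congr_ae (hs.mono fun ω h => h.tsum_eq),
    h1.unique (MMInfty.hasSum_meanWeight ρ z t), ← Complex.exp_add, mul_comm]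
  congr 2
  -- It remains to compare exponents: `M(t) - t = z(1-z)(1-e^{-t}) - (1-z²)t`.
  simp only [MMInfty.meanMark]
  push_cast
  ring
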